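/- Let $\mathcal G=(V,E)$ be a finite directed acyclic graph. For $i,j\in V$ let $P(i,j)$ be the set of directed paths from $i$ to $j$ (with the trivial path if $i=j$). For $C\in\mathbb R^E$ the weight of a path $\pi$ is $\omega_C(\pi)=\sum_{e\in\pi}c_e$, and $\pi\in P(i,j)$ is critical if its weight is maximal in $P(i,j)$; $C$ is generic if for all $i,j$ with $P(i,j)\neq\emptyset$ there is exactly one critical path from $i$ to $j$. For $L\subseteq V$, the critical DAG $\mathcal G^*_{C,L}$ has an edge $i\to j$ (for $i\ne j$) whenever $P(i,j)\neq\emptyset$ and no critical path from $i$ to $j$ has an intermediate node in $L$. For distinct $i,j\in V\setminus L$, the nodes $i$ and $j$ are $C^*$-separated given $L$ if, up to exchanging $i$ and $j$, $\mathcal G^*_{C,L}$ contains no path of one of the forms $i\to j$, $\; i\leftarrow p\to j$, $\; i\to\ell\leftarrow j$, $\; i\leftarrow p\to\ell\leftarrow j$, $\; i\leftarrow p\to\ell\leftarrow q\to j$ with distinct nodes, $\ell\in L$ and $p,q\notin L$. The maxoid $\mathcal M_C$ is the set of all triples $(I,J,L)$ of pairwise disjoint subsets of $V$ such that all $i\in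 I$ and $j\in J$ are $C^*$-separated given $L$. For generic $C$ put $\mathrm{cone}_{\mathcal G}(C)=\{C'\in\mathbb R^E \text{ generic}:\ \mathcal M_{C'}=\mathcal M_C\}$. The maxoid fan $\mathcal F_{\mathcal G}$ is the collection of the Euclidean closures of the sets $\mathrm{cone}_{\mathcal G}(C)$, $C$ generic, together with all faces of these closures. For $i,j$ with $|P(i,j)|\ge 1$ let $$f_{ij}=\sum_{\pi\in P(i,j)}\ \prod_{u\to v\in\pi}x_{uv}\in\mathbb R[x_{uv}:u\to v\in E]$$ be the path polynomial, and let $$P_{\mathcal G}=\sum_{\substack{i,j\in V\\ |P(i,j)|\ge 1}}\mathrm{Newt}(f_{ij})\subset\mathbb R^E$$ be the maxoid polytope, the Minkowski sum of the Newton polytopes. **Theorem.** The maxoid fan $\mathcal F_{\mathcal G}$ is equal to the outer normal fan of $P_{\mathcal G}$, that is, to the collection of the cones $N_F=\{c\in\mathbb R^E:\ \langle c,y\rangle\le\langle c,x\rangle\text{ for all }x\in F,\ y\in P_{\mathcal G}\}$ with $F$ a non-empty face of $P_{\mathcal G}$ (including $F=P_{\mathcal G}$). Moreover, $$P_{\mathcal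 G}=\mathrm{Newt}\Big(\prod_{\substack{i,j\in V\\ |P(i,j)|\ge1}} f_{ij}\Big),$$ so $\mathcal F_{\mathcal G}$ is also the normal fan of this Newton polytope. -/

import Mathlib

open scoped Matrix Pointwise

noncomputable section

namespace Maxoid

/-! ## Directed acyclic graphs, edges and directed paths -/

section Graph

variable {V : Type*}

/-- A digraph is acyclic if it has no directed cycle (in particular, no loop). -/
def IsAcyclic (G : Digraph V) : Prop := ∀ v : V, ¬ Relation.TransGen G.Adj v v

/-- The edge set `E` of a digraph, as a type. -/
def Edge (G : Digraph V) : Type _ := {e : V × V // G.Adj e.1 e.2}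

/-- `P(i, j)`: the directed paths from `i` to `j`, given by their lists of (distinct) vertices.
For `i = j` this contains the trivial path `[i]`. -/
def DirPath (G : Digraph V) (i j : V) : Type _ :=
  {π : List V // π.Nodup ∧ π.IsChain G.Adj ∧ π.head? = some i ∧ π.getLast? = some j}

variable [Fintype V]

instance instFiniteEdge (G : Digraph V) : Finite (Edge G) :=
  inferInstanceAs (Finite {e : V × V // G.Adj e.1 e.2})

instance instFintypeEdge (G : Digraph V) : Fintype (Edge G) := Fintype.ofFinite _

instance instFiniteDirPath (G : Digraph V) (i j : V) : Finite (DirPath G i j) :=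
  Finite.of_injective (β := {l : List V // l.Nodup}) (fun π => ⟨π.1, π.2.1⟩)
    (fun _ _ h => Subtype.ext (congrArg (fun l => l.1) h))

instance instFintypeDirPath (G : Digraph V) (i j : V) : Fintype (DirPath G i j) :=
  Fintype.ofFinite _

variable {G : Digraph V} {i j : V}

open Classical in
/-- The edges `u → v` of a directed path: the pairs `u, v` of consecutive vertices. -/
def DirPath.edges (π : DirPath G i j) : Finset (Edge G) :=
  Finset.univ.filter fun e => [e.1.1, e.1.2] <:+: π.1

/-- The weight `ω_C(π)` of a path. A weight matrix `C` supported on `G` is a point of `ℝ^E`. -/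
def DirPath.weight (π : DirPath G i j) (C : Edge G → ℝ) : ℝ := ∑ e ∈ π.edges, C e

/-- A path from `i` to `j` is critical if its weight is maximal among all paths in `P(i, j)`. -/
def DirPath.IsCritical (π : DirPath G i j) (C : Edge G → ℝ) : Prop :=
  ∀ π' : DirPath G i j, π'.weight C ≤ π.weight C

/-- `C` is generic if between any two nodes joined by a directed path there is a unique
critical path. -/
def IsGeneric (G : Digraph V) (C : Edge G → ℝ) : Prop :=
  ∀ i j : V, Nonempty (DirPath G i j) → ∃! π : DirPath G i j, π.IsCritical C

/-! ## `C*`-separation and maxoids -/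

/-- The edges of the critical DAG of `(G, C)` with respect to `L`: there is an edge `i → j` if
there is a directed path from `i` to `j ≠ i` and no critical path from `i` to `j` passes through
an (intermediate) node in `L`. -/
def CritAdj (G : Digraph V) (C : Edge G → ℝ) (L : Set V) (i j : V) : Prop :=
  i ≠ j ∧ Nonempty (DirPath G i j) ∧
    ∀ π : DirPath G i j, π.IsCritical C → ∀ v ∈ π.1, v ≠ i → v ≠ j → v ∉ L

/-- The five types of `*`-connecting paths from `i` to `j` given `L` in the critical DAG:
(a) `i → j`, (b) `i ← p → j`, (c) `i → ℓ ← j`, (d) `i ← p → ℓ ← j`,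
(e) `i ← p → ℓ ← q → j`, where `ℓ ∈ L` and `p, q ∉ L`. -/
def StarPath (G : Digraph V) (C : Edge G → ℝ) (L : Set V) (i j : V) : Prop :=
  CritAdj G C L i j ∨
  (∃ p, p ∉ L ∧ CritAdj G C L p i ∧ CritAdj G C L p j) ∨
  (∃ l, l ∈ L ∧ CritAdj G C L i l ∧ CritAdj G C L j l) ∨
  (∃ p l, p ∉ L ∧ l ∈ L ∧ p ≠ j ∧
    CritAdj G C L p i ∧ CritAdj G C L p l ∧ CritAdj G C L j l) ∨
  (∃ p l q, p ∉ L ∧ l ∈ L ∧ q ∉ L ∧ p ≠ q ∧ p ≠ j ∧ q ≠ i ∧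
    CritAdj G C L p i ∧ CritAdj G C L p l ∧ CritAdj G C L q l ∧ CritAdj G C L q j)

/-- `i` and `j` are `C*`-separated given `L` if no `*`-connecting path joins them, in either
direction. -/
def CSep (G : Digraph V) (C : Edge G → ℝ) (i j : V) (L : Set V) : Prop :=
  ¬ StarPath G C L i j ∧ ¬ StarPath G C L j i

/-- The maxoid of `(G, C)`: all conditional independence statements `I ⟂ J | L`, with `I, J, L`
pairwise disjoint sets of nodes, such that all `i ∈ I` and `j ∈ J` are `C*`-separated given `L`. -/
def maxoid (G : Digraph V) (C : Edge G → ℝ) : Set (Set V × Set V × Set V) :=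
  {s | Disjoint s.1 s.2.1 ∧ Disjoint s.1 s.2.2 ∧ Disjoint s.2.1 s.2.2 ∧
    ∀ i ∈ s.1, ∀ j ∈ s.2.1, CSep G C i j s.2.2}

/-- `cone_G(C)`: the generic weights with the same maxoid as `C`. -/
def maxoidCone (G : Digraph V) (C : Edge G → ℝ) : Set (Edge G → ℝ) :=
  {C' | IsGeneric G C' ∧ maxoid G C = maxoid G C'}

end Graph

/-! ## Cones, polytopes and normal fans in `ℝ^ι` -/

section Polyhedra

variable {ι : Type*} [Fintype ι]

/-- `F` is a face of the cone `K` (`u = 0` gives `K` itself). -/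
def IsConeFace (K F : Set (ι → ℝ)) : Prop :=
  ∃ u : ι → ℝ, (∀ x ∈ K, 0 ≤ u ⬝ᵥ x) ∧ F = {x ∈ K | u ⬝ᵥ x = 0}

/-- `F` is a non-empty face of the polytope `P` (`u = 0` gives `P` itself). -/
def IsPolytopeFace (P F : Set (ι → ℝ)) : Prop :=
  F.Nonempty ∧ ∃ u : ι → ℝ, F = {x ∈ P | ∀ y ∈ P, u ⬝ᵥ y ≤ u ⬝ᵥ x}

/-- The (outer) normal cone `N_F`: the functionals that attain their maximum over `P` at every
point of `F`. -/
def normalCone (P F : Set (ι → ℝ)) : Set (ι → ℝ) :=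
  {c | ∀ x ∈ F, ∀ y ∈ P, c ⬝ᵥ y ≤ c ⬝ᵥ x}

/-- The (outer) normal fan of `P`: the collection of the normal cones of its non-empty faces. -/
def normalFan (P : Set (ι → ℝ)) : Set (Set (ι → ℝ)) :=
  {N | ∃ F, IsPolytopeFace P F ∧ N = normalCone P F}

end Polyhedra

/-- The Newton polytope of a polynomial: the convex hull of the exponent vectors of its terms. -/
def newtonPolytope {σ : Type*} (f : MvPolynomial σ ℝ) : Set (σ → ℝ) :=
  convexHull ℝ ((fun (m : σ →₀ ℕ) (s : σ) => (m s : ℝ)) '' (f.support : Set (σ →₀ ℕ)))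

/-! ## The maxoid fan and the maxoid polytope -/

section Main

variable {V : Type*} [Fintype V]

/-- The maxoid fan `F_G` in `ℝ^E`: the cones are the Euclidean closures of the cones `cone_G(C)`
with `C` generic, together with all their faces. -/
def maxoidFan (G : Digraph V) : Set (Set (Edge G → ℝ)) :=
  {F | ∃ C : Edge G → ℝ, IsGeneric G C ∧ IsConeFace (closure (maxoidCone G C)) F}

/-- The path polynomial `f_ij`: the sum over `π ∈ P(i, j)` of the products of the variables
`x_uv` over the edges `u → v` of `π`. -/
def pathPolynomial (G : Digraph V) (i j : V) : MvPolynomial (Edge G) ℝ :=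
  ∑ π : DirPath G i j, ∏ e ∈ π.edges, MvPolynomial.X e

open Classical in
/-- The pairs `(i, j)` with `|P(i, j)| ≥ 1`. -/
def connectedPairs (G : Digraph V) : Finset (V × V) :=
  Finset.univ.filter fun p => Nonempty (DirPath G p.1 p.2)

/-- The maxoid polytope `P_G`: the Minkowski sum of the Newton polytopes of the path
polynomials `f_ij` over all pairs with `|P(i, j)| ≥ 1`. -/
def maxoidPolytope (G : Digraph V) : Set (Edge G → ℝ) :=
  ∑ p ∈ connectedPairs G, newtonPolytope (pathPolynomial G p.1 p.2)

end Main

end Maxoid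

end

/-! The bridge between the two fans is that, for generic weights, the maxoid and the collection of
critical paths determine each other. One direction is immediate, since the critical DAGs see only
critical paths. Conversely, if critical paths for `C` and `C'` part after a common node, a
well-chosen set of ancestors yields a separation statement that distinguishes the maxoids
(`maxoid_ne_of_diverging`, `critical_eq_of_maxoid_eq`).

The closure of `cone_G(C)` is therefore the set of weights for which all `C`-critical paths are
critical. Adding the edge indicators of these paths over all connected pairs gives a point of the
polytope, and maximizing over a Minkowski sum is maximizing in each summand, so this set is the
normal cone at that point (`closure_maxoidCone`). Any weight has a generic refinement, so every face
of the polytope contains such a point. The rest is duality: faces of the normal cone at a vertex are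
the normal cones of faces containing it. The product formula holds because nonnegative coefficients
cannot cancel. -/

namespace Maxoid

/-! ## Directed paths -/

section Paths

variable {V : Type*} {G : Digraph V} {i j v : V}

/-- The edge `i → v`. -/
def Edge.of (h : G.Adj i v) : Edge G := ⟨(i, v), h⟩

/-- The trivial path. -/
def DirPath.nil (G : Digraph V) (i : V) : DirPath G i i := ⟨[i], by simp⟩

theorem DirPath.reach_of_mem (π : DirPath G i j) {x : V} (hx : x ∈ π.1) :
    Relation.ReflTransGen G.Adj i x := by
  revert hx
  obtain ⟨l, hn, hc, hi, hj⟩ := π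
  intro hx
  replace hx : x ∈ l := hx
  clear hn hj
  induction l generalizing i with
  | nil => simp at hx
  | cons a l ih =>
    obtain rfl : a = i := by simpa using hi
    rcases List.mem_cons.1 hx with rfl | hx
    · exact .refl
    · cases l with
      | nil => simp at hx
      | cons b l =>
        rw [List.isChain_cons_cons] at hc
        exact .head hc.1 (ih hc.2 rfl hx)

theorem DirPath.mem_head (π : DirPath G i j) : i ∈ π.1 :=
  List.mem_of_mem_head? π.2.2.2.1

theorem DirPath.mem_last (π : DirPath G i j) : j ∈ π.1 :=
  List.mem_of_mem_getLast? π.2.2.2.2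

theorem DirPath.reach (π : DirPath G i j) : Relation.ReflTransGen G.Adj i j :=
  π.reach_of_mem π.mem_last

theorem DirPath.notMem_of_adj (hG : IsAcyclic G) (h : G.Adj i v) (σ : DirPath G v j) :
    i ∉ σ.1 := fun hi => hG i (.head' h (σ.reach_of_mem hi))

/-- Prepending an edge to a path. -/
def DirPath.cons (hG : IsAcyclic G) (h : G.Adj i v) (σ : DirPath G v j) : DirPath G i j :=
  ⟨i :: σ.1, List.nodup_cons.2 ⟨σ.notMem_of_adj hG h, σ.2.1⟩,
    List.isChain_cons.2 ⟨fun y hy => by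
      rw [σ.2.2.2.1, Option.mem_some_iff] at hy; exact hy ▸ h, σ.2.2.1⟩, rfl, by
    rw [List.getLast?_cons, σ.2.2.2.2]; rfl⟩

theorem DirPath.induction (hG : IsAcyclic G) {motive : ∀ i, DirPath G i j → Prop}
    (nil : motive j (DirPath.nil G j))
    (cons : ∀ i v (h : G.Adj i v) (σ : DirPath G v j), motive v σ → motive i (σ.cons hG h)) :
    ∀ i (π : DirPath G i j), motive i π := by
  rintro i ⟨l, hn, hc, hi, hj⟩
  induction l generalizing i with
  | nil => simp at hi
  | cons a l ih =>
    obtain rfl : a = i := by simpa using hi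
    cases l with
    | nil =>
      obtain rfl : a = j := by simpa using hj
      exact nil
    | cons b l =>
      rw [List.isChain_cons_cons] at hc
      rw [List.getLast?_cons_cons] at hj
      exact cons a b hc.1 _ (ih b (List.nodup_cons.1 hn).2 hc.2 rfl hj)

theorem transGen_of_dirPath (π : DirPath G i j) (hij : i ≠ j) :
    Relation.TransGen G.Adj i j :=
  (Relation.reflTransGen_iff_eq_or_transGen.1 π.reach).resolve_left (Ne.symm hij)

theorem DirPath.eq_nil_or_cons (hG : IsAcyclic G) (π : DirPath G i j) :
    (i = j ∧ π.1 = [j]) ∨ ∃ (v : V) (h : G.Adj i v) (σ : DirPath G v j), π = σ.cons hG h := by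
  refine DirPath.induction hG (motive := fun i π => (i = j ∧ π.1 = [j]) ∨
    ∃ (v : V) (h : G.Adj i v) (σ : DirPath G v j), π = σ.cons hG h) (.inl ⟨rfl, rfl⟩) ?_ i π
  exact fun i v h σ _ => .inr ⟨v, h, σ, rfl⟩

theorem DirPath.eq_nil (hG : IsAcyclic G) (π : DirPath G i i) : π = .nil G i := by
  rcases π.eq_nil_or_cons hG with ⟨-, h⟩ | ⟨v, h, σ, -⟩
  · exact Subtype.ext h
  · exact absurd (Relation.TransGen.head' h σ.reach) (hG i)

theorem DirPath.exists_cons (hG : IsAcyclic G) (π : DirPath G i j) (hij : i ≠ j) :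
    ∃ (v : V) (h : G.Adj i v) (σ : DirPath G v j), π = σ.cons hG h :=
  (π.eq_nil_or_cons hG).resolve_left fun h => hij h.1

theorem ne_of_adj_of_dirPath (hG : IsAcyclic G) (h : G.Adj i v) (σ : DirPath G v j) : i ≠ j := by
  rintro rfl; exact hG _ (.head' h σ.reach)

/-! ### Edges and weights of paths -/

variable [Fintype V]

theorem DirPath.mem_edges {π : DirPath G i j} {e : Edge G} :
    e ∈ π.edges ↔ [e.1.1, e.1.2] <:+: π.1 := by
  simp [DirPath.edges]

theorem DirPath.mem_edges_cons (hG : IsAcyclic G) (h : G.Adj i v) (σ : DirPath G v j)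
    {e : Edge G} : e ∈ (σ.cons hG h).edges ↔ e = Edge.of h ∨ e ∈ σ.edges := by
  rw [mem_edges, mem_edges, DirPath.cons, List.infix_cons_iff]
  refine or_congr ?_ Iff.rfl
  obtain ⟨l, -, -, hl, -⟩ := σ
  obtain ⟨⟨x, y⟩, he⟩ := e
  cases l with
  | nil => simp at hl
  | cons a l =>
    obtain rfl : a = v := by simpa using hl
    change [x, y] <+: i :: a :: l ↔
      (⟨(x, y), he⟩ : {e : V × V // G.Adj e.1 e.2}) = ⟨(i, a), h⟩
    simp [List.cons_prefix_cons]

theorem DirPath.notMem_edges_of_adj (hG : IsAcyclic G) (h : G.Adj i v) (σ : DirPath G v j)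
    {e : Edge G} (he : e.1.1 = i) : e ∉ σ.edges := fun hm => by
  rw [mem_edges, he] at hm
  exact σ.notMem_of_adj hG h (hm.subset (by simp))

open Classical in
theorem DirPath.weight_cons (hG : IsAcyclic G) (h : G.Adj i v) (σ : DirPath G v j)
    (C : Edge G → ℝ) : (σ.cons hG h).weight C = C (Edge.of h) + σ.weight C := by
  have : (σ.cons hG h).edges = insert (Edge.of h) σ.edges := by
    ext e; rw [mem_edges_cons, Finset.mem_insert]
  rw [weight, this, Finset.sum_insert (σ.notMem_edges_of_adj hG h rfl), weight]

/-- By acyclicity only the first edge of a path leaves its start node, so the edge set reveals the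
path step by step. -/
theorem DirPath.edges_injective (hG : IsAcyclic G) :
    Function.Injective (DirPath.edges : DirPath G i j → Finset (Edge G)) := by
  intro π
  refine DirPath.induction hG (motive := fun i π => ∀ π' : DirPath G i j,
    π.edges = π'.edges → π = π') (fun π' _ => (π'.eq_nil hG).symm) ?_ i π
  · intro i v h σ ih π' he
    obtain ⟨u, h', σ', rfl⟩ := π'.exists_cons hG (ne_of_adj_of_dirPath hG h σ)
    have h1 : (Edge.of h : Edge G) ∈ (σ'.cons hG h').edges := by
      rw [← he, mem_edges_cons]; exact .inl rfl
    rw [mem_edges_cons] at h1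
    have h2 := h1.resolve_right (σ'.notMem_edges_of_adj hG h' rfl)
    obtain rfl : v = u := congrArg (fun e => e.1.2) h2
    rw [ih σ']
    ext e
    have h3 : e ∈ (σ.cons hG h).edges ↔ e ∈ (σ'.cons hG h').edges := by rw [he]
    rw [mem_edges_cons, mem_edges_cons] at h3
    by_cases hei : e.1.1 = i
    · exact iff_of_false (σ.notMem_edges_of_adj hG h hei) (σ'.notMem_edges_of_adj hG h hei)
    · have : e ≠ Edge.of h := fun h => hei (by rw [h]; rfl)
      simpa [this] using h3

/-- A heavier tail would give a heavier path after prepending the same edge. -/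
theorem DirPath.IsCritical.of_cons (hG : IsAcyclic G) {h : G.Adj i v} {σ : DirPath G v j}
    {C : Edge G → ℝ} (hc : (σ.cons hG h).IsCritical C) : σ.IsCritical C := fun σ' => by
  have := hc (σ'.cons hG h)
  rw [weight_cons, weight_cons] at this
  linarith

/-! ## Maxoids determine critical paths -/

/-- Conditioning on the ancestors of `v` (with `v`, without `i`) blocks the `C`-critical path at
`v`. The `C'`-critical path continues through descendants of `u`, none of which reaches `v`, so it
avoids the conditioning set and `i → j` survives for `C'`. -/
theorem maxoid_ne_of_diverging (hG : IsAcyclic G) {C C' : Edge G → ℝ} (hC' : IsGeneric G C')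
    {u : V} {h : G.Adj i v} {σ : DirPath G v j} {h' : G.Adj i u} {σ' : DirPath G u j}
    (hπ : (σ.cons hG h).IsCritical C) (hπ' : (σ'.cons hG h').IsCritical C')
    (huv : ¬ Relation.ReflTransGen G.Adj u v) : maxoid G C ≠ maxoid G C' := by
  have hij : i ≠ j := ne_of_adj_of_dirPath hG h σ
  have hvj : v ≠ j := by
    rintro rfl; exact huv σ'.reach
  have hiv : i ≠ v := by
    rintro rfl; exact hG _ (.single h)
  have hvj' : Relation.TransGen G.Adj v j := transGen_of_dirPath σ hvj
  set L : Set V := {x | Relation.ReflTransGen G.Adj x v ∧ x ≠ i} with hL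
  have hvL : v ∈ L := ⟨.refl, hiv.symm⟩
  have hjL : j ∉ L := fun h => hG v (hvj'.trans_left h.1)
  have crit_trans : ∀ {D : Edge G → ℝ} {a b : V}, CritAdj G D L a b →
      Relation.TransGen G.Adj a b := fun h => transGen_of_dirPath h.2.1.some h.1
  have anc : ∀ {D : Edge G → ℝ} {p : V}, CritAdj G D L p i → p ∈ L := fun {D p} hp => by
    have := crit_trans hp
    exact ⟨(this.tail h).to_reflTransGen, hp.1⟩
  have hji : ¬ Relation.TransGen G.Adj j i := fun hji =>
    hG i ((Relation.TransGen.head' h σ.reach).trans hji)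
  have hjl : ∀ {D : Edge G → ℝ} {l : V}, l ∈ L → ¬ CritAdj G D L j l := fun hl hc =>
    hG j (((crit_trans hc).trans_left hl.1).trans hvj')
  have hsep : (({i}, {j}, L) : Set V × Set V × Set V) ∈ maxoid G C := by
    refine ⟨by simpa using hij, by simp [hL], by simpa using hjL, ?_⟩
    intro i' hi' j' hj'
    obtain rfl : i' = i := hi'
    obtain rfl : j' = j := hj'
    constructor
    -- The edge `i → j` is blocked by `v`. Every other form either needs a parent of `i` outside
    -- `L`, although all ancestors of `i` lie in `L`, or has an edge from `j` into `L`, closing a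
    -- cycle through `v`.
    · rintro (h1 | ⟨p, hp, h1, -⟩ | ⟨l, hl, -, h1⟩ | ⟨p, l, hp, -, -, h1, -⟩ |
        ⟨p, l, q, hp, -, -, -, -, -, h1, -⟩)
      · refine h1.2.2 _ hπ v ?_ hiv.symm hvj hvL
        exact List.mem_cons_of_mem _ σ.mem_head
      · exact hp (anc h1)
      · exact hjl hl h1
      · exact hp (anc h1)
      · exact hp (anc h1)
    · rintro (h1 | ⟨p, hp, -, h1⟩ | ⟨l, hl, h1, -⟩ | ⟨p, l, hp, hl, hpi, -, h1, -⟩ |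
        ⟨p, l, q, -, -, hq, -, -, -, -, -, -, h1⟩)
      · exact hji (crit_trans h1)
      · exact hp (anc h1)
      · exact hjl hl h1
      -- Here `p` lies in `L` because it reaches `v` through `l`.
      · exact hp ⟨(crit_trans h1).to_reflTransGen.trans hl.1, hpi⟩
      · exact hq (anc h1)
  intro heq
  rw [heq] at hsep
  refine (hsep.2.2.2 i rfl j rfl).1 (.inl ⟨hij, ⟨σ.cons hG h⟩, ?_⟩)
  intro π hπc x hx hxi _ hxL
  obtain rfl := (hC' i j ⟨π⟩).unique hπc hπ'
  rcases List.mem_cons.1 hx with rfl | hx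
  · exact hxi rfl
  · exact huv ((σ'.reach_of_mem hx).trans hxL.1)

theorem critical_eq_of_maxoid_eq (hG : IsAcyclic G) {C C' : Edge G → ℝ} (hC : IsGeneric G C)
    (hC' : IsGeneric G C') (hM : maxoid G C = maxoid G C') {π π' : DirPath G i j}
    (hπ : π.IsCritical C) (hπ' : π'.IsCritical C') : π = π' := by
  refine DirPath.induction hG (motive := fun i π => ∀ π' : DirPath G i j, π.IsCritical C →
    π'.IsCritical C' → π = π') (fun π' _ _ => (π'.eq_nil hG).symm) ?_ i π π' hπ hπ'
  · intro i v h σ ih π' hπ hπ'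
    obtain ⟨u, h', σ', rfl⟩ := π'.exists_cons hG (ne_of_adj_of_dirPath hG h σ)
    rcases eq_or_ne v u with rfl | hvu
    · rw [ih _ (hπ.of_cons hG) (hπ'.of_cons hG)]
    -- Distinct `u` and `v` cannot reach each other both ways, so the diverging lemma applies after
    -- possibly exchanging `C` and `C'`.
    · by_cases huv : Relation.ReflTransGen G.Adj u v
      · refine absurd hM.symm (maxoid_ne_of_diverging hG hC hπ' hπ fun hvu' => ?_)
        have h1 := (Relation.reflTransGen_iff_eq_or_transGen.1 huv).resolve_left hvu
        exact hG u (h1.trans_left hvu')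
      · exact absurd hM (maxoid_ne_of_diverging hG hC' hπ hπ' huv)

theorem maxoid_eq_of_isCritical_iff {C C' : Edge G → ℝ}
    (h : ∀ (i j : V) (π : DirPath G i j), π.IsCritical C ↔ π.IsCritical C') :
    maxoid G C = maxoid G C' := by
  have : CritAdj G C = CritAdj G C' := by
    funext L i j
    simp only [CritAdj, h]
  simp only [maxoid, CSep, StarPath, this]

end Paths

end Maxoid

namespace Maxoid

/-! ## Normal cones of convex hulls of finite sets -/

section Polytopes

variable {ι : Type*} [Fintype ι]

theorem dotProduct_le_of_mem_convexHull {S : Set (ι → ℝ)} {c : ι → ℝ} {m : ℝ}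
    (h : ∀ y ∈ S, c ⬝ᵥ y ≤ m) {y : ι → ℝ} (hy : y ∈ convexHull ℝ S) : c ⬝ᵥ y ≤ m :=
  convexHull_min (t := {w | c ⬝ᵥ w ≤ m}) h
    (convex_halfSpace_le ⟨dotProduct_add c, fun a x => dotProduct_smul a c x⟩ m) hy

theorem mem_normalCone_singleton {S : Set (ι → ℝ)} {c x : ι → ℝ} :
    c ∈ normalCone (convexHull ℝ S) {x} ↔ ∀ y ∈ S, c ⬝ᵥ y ≤ c ⬝ᵥ x :=
  ⟨fun h y hy => h x rfl y (subset_convexHull ℝ S hy), fun h _ hx _ hy =>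
    Set.mem_singleton_iff.1 hx ▸ dotProduct_le_of_mem_convexHull h hy⟩

/-- The normal cone of the face of `convexHull ℝ S` exposed by `u` is determined by the points
of `S` in that face. -/
theorem mem_normalCone_face {S : Set (ι → ℝ)} (hS : S.Finite) {u c x₀ : ι → ℝ} (hx₀ : x₀ ∈ S)
    (hu : ∀ y ∈ S, u ⬝ᵥ y ≤ u ⬝ᵥ x₀) :
    c ∈ normalCone (convexHull ℝ S)
        {x ∈ convexHull ℝ S | ∀ y ∈ convexHull ℝ S, u ⬝ᵥ y ≤ u ⬝ᵥ x} ↔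
      c ∈ normalCone (convexHull ℝ S) {x₀} ∧
        ∀ t ∈ S, u ⬝ᵥ t = u ⬝ᵥ x₀ → c ⬝ᵥ t = c ⬝ᵥ x₀ := by
  have hu' : ∀ y ∈ convexHull ℝ S, u ⬝ᵥ y ≤ u ⬝ᵥ x₀ :=
    fun y hy => dotProduct_le_of_mem_convexHull hu hy
  have hsub := subset_convexHull ℝ S
  constructor
  · intro h
    refine ⟨fun x hx => ?_, fun t ht hut => le_antisymm ?_ ?_⟩
    · obtain rfl := Set.mem_singleton_iff.1 hx
      exact h x ⟨hsub hx₀, hu'⟩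
    · exact h x₀ ⟨hsub hx₀, hu'⟩ t (hsub ht)
    · exact h t ⟨hsub ht, fun y hy => hut ▸ hu' y hy⟩ x₀ (hsub hx₀)
  · rintro ⟨h1, h2⟩ x ⟨hx, hux⟩ y hy
    have h3 : c ⬝ᵥ x = c ⬝ᵥ x₀ := by
      lift S to Finset (ι → ℝ) using hS
      obtain ⟨w, hw0, hw1, rfl⟩ := Finset.mem_convexHull'.1 hx
      -- Complementary slackness: a convex combination that is maximal for `u` gives positive weight
      -- only to maximal points.
      have key : ∀ t ∈ S, w t * (u ⬝ᵥ x₀ - u ⬝ᵥ t) = 0 := by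
        refine (Finset.sum_eq_zero_iff_of_nonneg fun t ht =>
          mul_nonneg (hw0 t ht) (sub_nonneg.2 (hu t ht))).1 ?_
        have h4 := le_antisymm (hu' _ hx) (hux x₀ (hsub hx₀))
        simp only [dotProduct_sum, dotProduct_smul, smul_eq_mul] at h4
        simp only [mul_sub, Finset.sum_sub_distrib, ← Finset.sum_mul, hw1, h4, one_mul, sub_self]
      rw [dotProduct_sum]
      calc ∑ t ∈ S, c ⬝ᵥ (w t • t) = ∑ t ∈ S, w t * (c ⬝ᵥ x₀) := by
            refine Finset.sum_congr rfl fun t ht => ?_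
            rw [dotProduct_smul, smul_eq_mul]
            rcases mul_eq_zero.1 (key t ht) with h | h
            · rw [h, zero_mul, zero_mul]
            · rw [h2 t ht (sub_eq_zero.1 h).symm]
        _ = c ⬝ᵥ x₀ := by rw [← Finset.sum_mul, hw1, one_mul]
    exact h3 ▸ h1 x₀ rfl y hy

/-- The normal cone of a face is a face of the normal cone of each vertex of the face. -/
theorem isConeFace_normalCone {S : Set (ι → ℝ)} (hS : S.Finite) {u x₀ : ι → ℝ} (hx₀ : x₀ ∈ S)
    (hu : ∀ y ∈ S, u ⬝ᵥ y ≤ u ⬝ᵥ x₀) :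
    IsConeFace (normalCone (convexHull ℝ S) {x₀}) (normalCone (convexHull ℝ S)
        {x ∈ convexHull ℝ S | ∀ y ∈ convexHull ℝ S, u ⬝ᵥ y ≤ u ⬝ᵥ x}) := by
  classical
  set T := hS.toFinset.filter fun t => u ⬝ᵥ t = u ⬝ᵥ x₀ with hT
  have hdot : ∀ c : ι → ℝ, (∑ t ∈ T, (x₀ - t)) ⬝ᵥ c = ∑ t ∈ T, (c ⬝ᵥ x₀ - c ⬝ᵥ t) := fun c => by
    rw [dotProduct_comm, dotProduct_sum]
    simp only [dotProduct_sub]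
  have hnn : ∀ c ∈ normalCone (convexHull ℝ S) {x₀}, ∀ t ∈ T, 0 ≤ c ⬝ᵥ x₀ - c ⬝ᵥ t :=
    fun c hc t ht => by
      simp only [hT, Finset.mem_filter, Set.Finite.mem_toFinset] at ht
      exact sub_nonneg.2 (mem_normalCone_singleton.1 hc t ht.1)
  -- Each `x₀ - t` is nonnegative on the normal cone, so the sum vanishes exactly where all of them
  -- do.
  refine ⟨∑ t ∈ T, (x₀ - t), fun c hc => ?_, Set.ext fun c => ?_⟩
  · rw [hdot]
    exact Finset.sum_nonneg (hnn c hc)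
  · rw [mem_normalCone_face hS hx₀ hu, Set.mem_ofPred_eq]
    refine and_congr_right fun hc => ?_
    rw [hdot, Finset.sum_eq_zero_iff_of_nonneg (hnn c hc)]
    simp only [hT, Finset.mem_filter, Set.Finite.mem_toFinset, and_imp, sub_eq_zero]
    exact forall₃_congr fun _ _ _ => eq_comm

/-- The faces of the normal cone of a vertex are normal cones of faces. -/
theorem mem_normalFan_of_isConeFace {S : Set (ι → ℝ)} (hS : S.Finite) {x₀ : ι → ℝ} (hx₀ : x₀ ∈ S)
    {N : Set (ι → ℝ)} (hN : IsConeFace (normalCone (convexHull ℝ S) {x₀}) N) :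
    N ∈ normalFan (convexHull ℝ S) := by
  classical
  obtain ⟨u, hu, rfl⟩ := hN
  simp only [mem_normalCone_singleton] at hu
  set N := {x ∈ normalCone (convexHull ℝ S) {x₀} | u ⬝ᵥ x = 0} with hNdef
  have hmem : ∀ {c}, c ∈ N ↔ (∀ y ∈ S, c ⬝ᵥ y ≤ c ⬝ᵥ x₀) ∧ u ⬝ᵥ c = 0 := by
    simp only [hNdef, Set.mem_ofPred_eq, mem_normalCone_singleton, implies_true]
  have hch : ∀ y, ∃ c ∈ N, (∃ d ∈ N, d ⬝ᵥ y ≠ d ⬝ᵥ x₀) → c ⬝ᵥ y ≠ c ⬝ᵥ x₀ := fun y => by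
    by_cases h : ∃ d ∈ N, d ⬝ᵥ y ≠ d ⬝ᵥ x₀
    · exact h.imp fun d hd => ⟨hd.1, fun _ => hd.2⟩
    · exact ⟨0, hmem.2 ⟨by simp, by simp⟩, fun h' => absurd h' h⟩
  -- `d y` separates `y` from `x₀` whenever some element of `N` does. The sum `c₀` then separates
  -- all such points of `S` at once, acting as a relative interior point of `N`.
  choose d hdN hd using hch
  set c₀ := ∑ y ∈ hS.toFinset, d y with hc₀
  have hdot : ∀ x, c₀ ⬝ᵥ x = ∑ y ∈ hS.toFinset, d y ⬝ᵥ x := fun x => by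
    rw [hc₀, sum_dotProduct]
  have hc₀N : c₀ ∈ N := hmem.2 ⟨fun y hy => by
    rw [hdot, hdot]
    exact Finset.sum_le_sum fun z _ => (hmem.1 (hdN z)).1 y hy, by
    rw [hc₀, dotProduct_sum]
    exact Finset.sum_eq_zero fun z _ => (hmem.1 (hdN z)).2⟩
  have hc₀le := (hmem.1 hc₀N).1
  have hact : ∀ t ∈ S, c₀ ⬝ᵥ t = c₀ ⬝ᵥ x₀ → ∀ c ∈ N, c ⬝ᵥ t = c ⬝ᵥ x₀ := by
    intro t ht h c hc
    by_contra hne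
    have hlt := lt_of_le_of_ne ((hmem.1 (hdN t)).1 t ht) (hd t ⟨c, hc, hne⟩)
    rw [hdot, hdot] at h
    exact absurd h (Finset.sum_lt_sum (fun z _ => (hmem.1 (hdN z)).1 t ht)
      ⟨t, hS.mem_toFinset.2 ht, hlt⟩).ne
  refine ⟨{x ∈ convexHull ℝ S | ∀ y ∈ convexHull ℝ S, c₀ ⬝ᵥ y ≤ c₀ ⬝ᵥ x},
    ⟨⟨x₀, subset_convexHull ℝ S hx₀, fun y hy => dotProduct_le_of_mem_convexHull hc₀le hy⟩, c₀, rfl⟩,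
    Set.ext fun c => ?_⟩
  rw [mem_normalCone_face hS hx₀ hc₀le]
  constructor
  · exact fun hc => ⟨hc.1, fun t ht h => hact t ht h c hc⟩
  · rintro ⟨hcK, hc⟩
    refine ⟨hcK, ?_⟩
    rw [mem_normalCone_singleton] at hcK
    -- Moving from `c₀` slightly away from `c` stays in the normal cone: ties for `c₀` are ties for
    -- `c`, and strict inequalities persist. Nonnegativity of `u` at `c` and at `c₀ - ε • c` then
    -- forces `u ⬝ᵥ c = 0`.
    have hev : ∀ᶠ ε : ℝ in nhdsWithin 0 (Set.Ioi 0), ∀ y ∈ S,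
        (c₀ - ε • c) ⬝ᵥ y ≤ (c₀ - ε • c) ⬝ᵥ x₀ := by
      refine (Filter.eventually_all_finite hS).2 fun y hy => ?_
      have hexp : ∀ ε : ℝ, (c₀ - ε • c) ⬝ᵥ y ≤ (c₀ - ε • c) ⬝ᵥ x₀ ↔
          0 ≤ (c₀ ⬝ᵥ x₀ - c₀ ⬝ᵥ y) - ε * (c ⬝ᵥ x₀ - c ⬝ᵥ y) := fun ε => by
        simp only [sub_dotProduct, smul_dotProduct, smul_eq_mul]
        constructor <;> intro h <;> linarith
      simp only [hexp]
      rcases eq_or_lt_of_le (hc₀le y hy) with h | h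
      · simp [h, hc y hy h]
      · have hcont : Continuous fun ε : ℝ =>
            (c₀ ⬝ᵥ x₀ - c₀ ⬝ᵥ y) - ε * (c ⬝ᵥ x₀ - c ⬝ᵥ y) := by fun_prop
        have := (hcont.continuousAt (x := 0)).eventually (lt_mem_nhds (a := 0) (by simpa using h))
        exact (this.filter_mono nhdsWithin_le_nhds).mono fun _ h => h.le
    obtain ⟨ε, hε, hε0⟩ := (hev.and self_mem_nhdsWithin).exists
    have h1 := hu _ hε
    have h2 := hu _ hcK
    rw [dotProduct_sub, dotProduct_smul, (hmem.1 hc₀N).2, smul_eq_mul] at h1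
    have hε0' : (0 : ℝ) < ε := hε0
    nlinarith

/-- Maximizing a functional over a Minkowski sum amounts to maximizing it over each summand. -/
theorem forall_sum_dotProduct_le_iff {α : Type*} {t : Finset α} {A : α → Set (ι → ℝ)}
    {x : α → ι → ℝ} (hx : ∀ p ∈ t, x p ∈ A p) {c : ι → ℝ} :
    (∀ y ∈ ∑ p ∈ t, A p, c ⬝ᵥ y ≤ c ⬝ᵥ ∑ p ∈ t, x p) ↔
      ∀ p ∈ t, ∀ a ∈ A p, c ⬝ᵥ a ≤ c ⬝ᵥ x p := by
  classical
  constructor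
  · intro h p hp a ha
    -- Changing only the summand at `p` isolates the inequality there.
    have := h (∑ q ∈ t, Function.update x p a q) (Set.mem_finsetSum _ _ _ |>.2
      ⟨_, fun {q} hq => ?_, rfl⟩)
    · rw [Finset.sum_update_of_mem hp, Finset.sdiff_singleton_eq_erase,
        ← Finset.add_sum_erase t x hp, dotProduct_add, dotProduct_add] at this
      linarith
    · rcases eq_or_ne q p with rfl | hqp
      · simpa using ha
      · simpa [hqp] using hx q hq
  · intro h y hy
    obtain ⟨g, hg, rfl⟩ := (Set.mem_finsetSum _ _ _).1 hy
    rw [dotProduct_sum, dotProduct_sum]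
    exact Finset.sum_le_sum fun p hp => h p hp _ (hg hp)

end Polytopes

/-! ## Newton polytopes of products -/

section Newton

variable {σ : Type*}

/-- The embedding of exponent vectors into real space. -/
def exponentHom (σ : Type*) : (σ →₀ ℕ) →+ (σ → ℝ) where
  toFun m s := m s
  map_zero' := by ext; simp
  map_add' _ _ := by ext; simp

/-- A coefficient of the product is a sum of nonnegative terms, so nothing cancels. -/
theorem support_mul_of_nonneg {f g : MvPolynomial σ ℝ} (hf : ∀ m, 0 ≤ f.coeff m)
    (hg : ∀ m, 0 ≤ g.coeff m) :
    ((f * g).support : Set (σ →₀ ℕ)) = (f.support : Set (σ →₀ ℕ)) + g.support := by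
  classical
  ext m
  rw [Finset.mem_coe, MvPolynomial.mem_support_iff, MvPolynomial.coeff_mul, ne_eq,
    Finset.sum_eq_zero_iff_of_nonneg fun x _ => mul_nonneg (hf _) (hg _), Set.mem_add]
  push Not
  simp only [Prod.exists, mul_ne_zero_iff, Finset.mem_coe,
    MvPolynomial.mem_support_iff]
  constructor
  · rintro ⟨a, b, h, ha, hb⟩; exact ⟨a, ha, b, hb, Finset.HasAntidiagonal.mem_antidiagonal.1 h⟩
  · rintro ⟨a, ha, b, hb, h⟩; exact ⟨a, b, Finset.HasAntidiagonal.mem_antidiagonal.2 h, ha, hb⟩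

theorem coeff_mul_nonneg {f g : MvPolynomial σ ℝ} (hf : ∀ m, 0 ≤ f.coeff m)
    (hg : ∀ m, 0 ≤ g.coeff m) (m : σ →₀ ℕ) : 0 ≤ (f * g).coeff m := by
  classical
  rw [MvPolynomial.coeff_mul]
  exact Finset.sum_nonneg fun x _ => mul_nonneg (hf _) (hg _)

theorem support_prod_of_nonneg {α : Type*} (t : Finset α) {f : α → MvPolynomial σ ℝ}
    (hf : ∀ a m, 0 ≤ (f a).coeff m) :
    (∀ m, 0 ≤ (∏ a ∈ t, f a).coeff m) ∧
      ((∏ a ∈ t, f a).support : Set (σ →₀ ℕ)) = ∑ a ∈ t, ((f a).support : Set (σ →₀ ℕ)) := by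
  classical
  induction t using Finset.induction_on with
  | empty =>
    refine ⟨fun m => ?_, ?_⟩
    · rw [Finset.prod_empty, MvPolynomial.coeff_one]
      split_ifs <;> norm_num
    · ext m
      simp
  | insert a t ha ih =>
    rw [Finset.prod_insert ha, Finset.sum_insert ha, support_mul_of_nonneg (hf a) ih.1, ih.2]
    exact ⟨coeff_mul_nonneg (hf a) ih.1, rfl⟩

theorem newtonPolytope_prod {α : Type*} (t : Finset α) {f : α → MvPolynomial σ ℝ}
    (hf : ∀ a m, 0 ≤ (f a).coeff m) :
    newtonPolytope (∏ a ∈ t, f a) = ∑ a ∈ t, newtonPolytope (f a) := by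
  change convexHull ℝ (exponentHom σ '' _) = ∑ a ∈ t, convexHull ℝ (exponentHom σ '' _)
  rw [(support_prod_of_nonneg t hf).2, Set.image_finsetSum, convexHull_sum]

end Newton

end Maxoid

namespace Maxoid

/-! ## Path polynomials and generic weights -/

section Fan

variable {V : Type*} [Fintype V] {G : Digraph V} {i j : V}

/-- The exponent vector of the monomial of a path. -/
noncomputable def DirPath.exponent (π : DirPath G i j) : Edge G →₀ ℕ := ∑ e ∈ π.edges, Finsupp.single e 1

/-- The indicator vector of the edges of a path. -/
noncomputable def DirPath.indicator (π : DirPath G i j) : Edge G → ℝ := exponentHom (Edge G) π.exponent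

theorem DirPath.dotProduct_indicator (π : DirPath G i j) (C : Edge G → ℝ) :
    C ⬝ᵥ π.indicator = π.weight C := by
  classical
  rw [indicator, exponent, map_sum, dotProduct_sum, weight]
  refine Finset.sum_congr rfl fun e _ => ?_
  have : exponentHom (Edge G) (Finsupp.single e 1) = Pi.single e 1 := by
    ext x
    simp [exponentHom, Finsupp.single_apply, Pi.single_apply, eq_comm]
  rw [this, dotProduct_single, mul_one]

open Classical in
theorem coeff_pathPolynomial (i j : V) (m : Edge G →₀ ℕ) :
    (pathPolynomial G i j).coeff m =
      ∑ π : DirPath G i j, if π.exponent = m then (1 : ℝ) else 0 := by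
  have h : ∀ π : DirPath G i j, ∏ e ∈ π.edges, (MvPolynomial.X e : MvPolynomial (Edge G) ℝ) =
      MvPolynomial.monomial π.exponent 1 := fun π => by
    rw [DirPath.exponent, MvPolynomial.monomial_sum_one]
    rfl
  rw [pathPolynomial, MvPolynomial.coeff_sum]
  simp only [h, MvPolynomial.coeff_monomial]

theorem coeff_pathPolynomial_nonneg (i j : V) (m : Edge G →₀ ℕ) :
    0 ≤ (pathPolynomial G i j).coeff m := by
  classical
  rw [coeff_pathPolynomial]
  exact Finset.sum_nonneg fun π _ => by split_ifs <;> norm_num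

theorem newtonPolytope_pathPolynomial (i j : V) :
    newtonPolytope (pathPolynomial G i j) =
      convexHull ℝ (Set.range (DirPath.indicator : DirPath G i j → Edge G → ℝ)) := by
  classical
  have : ((pathPolynomial G i j).support : Set (Edge G →₀ ℕ)) =
      Set.range (DirPath.exponent : DirPath G i j → _) := by
    ext m
    rw [Finset.mem_coe, MvPolynomial.mem_support_iff, coeff_pathPolynomial, ne_eq,
      Finset.sum_eq_zero_iff_of_nonneg fun π _ => by split_ifs <;> norm_num]
    simp
  rw [newtonPolytope, this, ← Set.range_comp]
  rfl

/-- The sums of path indicators, one path for each connected pair. -/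
noncomputable def pathSums (G : Digraph V) : Set (Edge G → ℝ) :=
  ∑ p ∈ connectedPairs G, Set.range (DirPath.indicator : DirPath G p.1 p.2 → Edge G → ℝ)

/-- Convex hulls commute with Minkowski sums. This makes the results on hulls of finite sets
available. -/
theorem maxoidPolytope_eq_convexHull (G : Digraph V) :
    maxoidPolytope G = convexHull ℝ (pathSums G) := by
  simp only [maxoidPolytope, newtonPolytope_pathPolynomial, pathSums, convexHull_sum]

theorem finite_pathSums (G : Digraph V) : (pathSums G).Finite := by
  classical
  rw [pathSums]
  induction connectedPairs G using Finset.induction_on with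
  | empty => simp
  | insert p t hp ih => rw [Finset.sum_insert hp]; exact (Set.finite_range _).add ih

theorem mem_connectedPairs {p : V × V} :
    p ∈ connectedPairs G ↔ Nonempty (DirPath G p.1 p.2) := by
  simp [connectedPairs]

open Classical in
/-- The sum of the indicators of the critical paths of a generic weight. -/
noncomputable def criticalVertex {C : Edge G → ℝ} (hC : IsGeneric G C) : Edge G → ℝ :=
  ∑ p ∈ connectedPairs G, if h : Nonempty (DirPath G p.1 p.2) then
    -- The default `0` is never taken, as all pairs in the sum are connected.
    (hC p.1 p.2 h).exists.choose.indicator else 0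

theorem criticalVertex_eq {C : Edge G → ℝ} (hC : IsGeneric G C) :
    ∃ x : V × V → Edge G → ℝ, criticalVertex hC = ∑ p ∈ connectedPairs G, x p ∧
      ∀ p ∈ connectedPairs G, ∃ π : DirPath G p.1 p.2, π.IsCritical C ∧ x p = π.indicator := by
  refine ⟨_, rfl, fun p hp => ?_⟩
  have h := mem_connectedPairs.1 hp
  exact ⟨_, (hC p.1 p.2 h).exists.choose_spec, dif_pos h⟩

theorem criticalVertex_mem {C : Edge G → ℝ} (hC : IsGeneric G C) :
    criticalVertex hC ∈ pathSums G := by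
  obtain ⟨x, h, hx⟩ := criticalVertex_eq hC
  exact (Set.mem_finsetSum _ _ _).2 ⟨x, fun {p} hp => (hx p hp).imp fun π h => h.2.symm, h.symm⟩

/-- A weight is maximized at the vertex of a generic weight `C` exactly when all critical paths
of `C` are critical for it. -/
theorem forall_pathSums_le_iff {C : Edge G → ℝ} (hC : IsGeneric G C) {D : Edge G → ℝ} :
    (∀ y ∈ pathSums G, D ⬝ᵥ y ≤ D ⬝ᵥ criticalVertex hC) ↔
      ∀ (i j : V) (π : DirPath G i j), π.IsCritical C → π.IsCritical D := by
  obtain ⟨x, h, hx⟩ := criticalVertex_eq hC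
  rw [h, pathSums, forall_sum_dotProduct_le_iff fun p hp => (hx p hp).imp fun π h => h.2.symm]
  constructor
  · intro h i j π hπ σ
    obtain ⟨τ, hτ, hxτ⟩ := hx (i, j) (mem_connectedPairs.2 ⟨π⟩)
    obtain rfl := (hC i j ⟨π⟩).unique hπ hτ
    have := h (i, j) (mem_connectedPairs.2 ⟨π⟩) _ ⟨σ, rfl⟩
    rwa [hxτ, DirPath.dotProduct_indicator, DirPath.dotProduct_indicator] at this
  · rintro h p hp _ ⟨σ, rfl⟩
    obtain ⟨τ, hτ, hxτ⟩ := hx p hp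
    rw [hxτ, DirPath.dotProduct_indicator, DirPath.dotProduct_indicator]
    exact h _ _ τ hτ σ

/-! ### Perturbations of weights and closures of maxoid cones -/

theorem DirPath.exists_isCritical (h : Nonempty (DirPath G i j)) (C : Edge G → ℝ) :
    ∃ π : DirPath G i j, π.IsCritical C := 
  Finite.exists_max fun π : DirPath G i j => π.weight C

theorem DirPath.weight_add_smul (π : DirPath G i j) (C D : Edge G → ℝ) (ε : ℝ) :
    π.weight (C + ε • D) = π.weight C + ε * π.weight D := by
  simp [weight, Finset.sum_add_distrib, Finset.mul_sum]

/-- If all critical paths of a generic `C` are critical for `D`, then small perturbations of `D`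
in direction `C` are generic with the same critical paths as `C`. -/
theorem isCritical_add_smul_iff {C D : Edge G → ℝ} (hC : IsGeneric G C)
    (h : ∀ (i j : V) (π : DirPath G i j), π.IsCritical C → π.IsCritical D) {ε : ℝ} (hε : 0 < ε)
    (π : DirPath G i j) : π.IsCritical C ↔ π.IsCritical (D + ε • C) := by
  have key : ∀ π : DirPath G i j, π.IsCritical C → π.IsCritical (D + ε • C) := fun π hπ σ => by
    rw [DirPath.weight_add_smul, DirPath.weight_add_smul]
    exact add_le_add (h _ _ π hπ σ) (mul_le_mul_of_nonneg_left (hπ σ) hε.le)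
  refine ⟨key π, fun hπ σ => ?_⟩
  obtain ⟨τ, hτ, -⟩ := hC i j ⟨π⟩
  have h1 := hπ τ
  have h2 := h _ _ τ hτ π
  rw [DirPath.weight_add_smul, DirPath.weight_add_smul] at h1
  exact (hτ σ).trans (le_of_mul_le_mul_left (by linarith) hε)

theorem IsGeneric.congr {C D : Edge G → ℝ} (hC : IsGeneric G C)
    (h : ∀ (i j : V) (π : DirPath G i j), π.IsCritical C ↔ π.IsCritical D) : IsGeneric G D := by
  intro i j hij
  simpa only [h] using hC i j hij

/-- The normal cone is closed and contains `cone_G(C)`. Conversely, each of its points `D` is the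
limit of `D + ε • C`, which lies in `cone_G(C)` for `ε > 0`. -/
theorem closure_maxoidCone (hG : IsAcyclic G) {C : Edge G → ℝ} (hC : IsGeneric G C) :
    closure (maxoidCone G C) = normalCone (maxoidPolytope G) {criticalVertex hC} := by
  rw [maxoidPolytope_eq_convexHull]
  have hK : ∀ {D}, D ∈ normalCone (convexHull ℝ (pathSums G)) {criticalVertex hC} ↔
      ∀ (i j : V) (π : DirPath G i j), π.IsCritical C → π.IsCritical D := fun {D} => by
    rw [mem_normalCone_singleton, forall_pathSums_le_iff]
  refine (closure_minimal ?_ ?_).antisymm fun D hD => ?_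
  · rintro D ⟨hD, hM⟩
    refine hK.2 fun i j π hπ => ?_
    obtain ⟨σ, hσ, -⟩ := hD i j ⟨π⟩
    rwa [critical_eq_of_maxoid_eq hG hC hD hM hπ hσ]
  · simp only [normalCone, Set.ofPred_forall]
    refine isClosed_iInter fun x => isClosed_iInter fun _ => isClosed_iInter fun y =>
      isClosed_iInter fun _ => isClosed_le ?_ ?_ <;> fun_prop
  · rw [hK] at hD
    have hmem : ∀ᶠ ε : ℝ in nhdsWithin 0 (Set.Ioi 0), D + ε • C ∈ maxoidCone G C := by
      filter_upwards [self_mem_nhdsWithin] with ε hε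
      have h := fun (i j : V) (π : DirPath G i j) => isCritical_add_smul_iff hC hD hε π
      exact ⟨hC.congr h, maxoid_eq_of_isCritical_iff h⟩
    refine mem_closure_of_tendsto (f := fun ε : ℝ => D + ε • C) ?_ hmem
    have hcont : Continuous fun ε : ℝ => D + ε • C := by fun_prop
    have := hcont.tendsto 0
    rw [zero_smul, add_zero] at this
    exact this.mono_left nhdsWithin_le_nhds

/-- There are weights separating all paths between two nodes. -/
theorem exists_weight_injective (hG : IsAcyclic G) : ∃ g : Edge G → ℝ, ∀ i j : V,
    Function.Injective fun π : DirPath G i j => π.weight g := by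
  classical
  let e := Fintype.equivFin (Edge G)
  let f : Edge G ↪ ℕ := e.toEmbedding.trans Fin.valEmbedding
  -- Distinct powers of two have distinct subset sums, so the weight recovers the edge set.
  refine ⟨fun x => ((2 ^ f x : ℕ) : ℝ), fun i j π σ h => ?_⟩
  refine DirPath.edges_injective hG (Finset.map_injective f (Finset.geomSum_injective le_rfl ?_))
  simpa only [DirPath.weight, ← Nat.cast_sum, Nat.cast_inj, Finset.sum_map] using h

/-- Every weight has arbitrarily small generic perturbations, whose critical paths are critical
for the original weight. -/
theorem exists_isGeneric_refinement (hG : IsAcyclic G) (u : Edge G → ℝ) :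
    ∃ C : Edge G → ℝ, IsGeneric G C ∧
      ∀ (i j : V) (π : DirPath G i j), π.IsCritical C → π.IsCritical u := by
  obtain ⟨g, hg⟩ := exists_weight_injective hG
  have hev : ∀ᶠ ε : ℝ in nhdsWithin 0 (Set.Ioi 0), ∀ (i j : V) (π σ : DirPath G i j),
      π.weight u < σ.weight u → π.weight (u + ε • g) < σ.weight (u + ε • g) := by
    simp only [Filter.eventually_all]
    intro i j π σ h
    simp only [DirPath.weight_add_smul]
    have h1 : Continuous fun ε : ℝ => π.weight u + ε * π.weight g := by fun_prop
    have h2 : Continuous fun ε : ℝ => σ.weight u + ε * σ.weight g := by fun_prop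
    exact ((h1.tendsto 0).eventually_lt (h2.tendsto 0) (by simpa using h)).filter_mono
      nhdsWithin_le_nhds
  obtain ⟨ε, hε, hε0⟩ := (hev.and self_mem_nhdsWithin).exists
  have hle : ∀ {i j : V} {π σ : DirPath G i j}, π.IsCritical (u + ε • g) →
      σ.weight u ≤ π.weight u := fun {i j π σ} hπ =>
    not_lt.1 fun h => (hε i j π σ h).not_ge (hπ σ)
  refine ⟨u + ε • g, fun i j hij => ?_, fun i j π hπ σ => hle hπ⟩
  obtain ⟨π, hπ⟩ := DirPath.exists_isCritical hij (u + ε • g)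
  -- Two critical paths for `u + ε • g` have equal `u`-weight, hence equal `g`-weight, hence
  -- coincide.
  refine ⟨π, hπ, fun σ hσ => hg i j ?_⟩
  have h1 := le_antisymm (hσ π) (hπ σ)
  have h2 := le_antisymm (hle (σ := π) hσ) (hle (σ := σ) hπ)
  rw [DirPath.weight_add_smul, DirPath.weight_add_smul, h2] at h1
  exact (mul_left_cancel₀ (ne_of_gt hε0) (add_left_cancel h1)).symm

theorem maxoidFan_eq_normalFan (hG : IsAcyclic G) :
    maxoidFan G = normalFan (maxoidPolytope G) := by
  have hP := maxoidPolytope_eq_convexHull G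
  ext N
  constructor
  · rintro ⟨C, hC, hN⟩
    rw [closure_maxoidCone hG hC, hP] at hN
    exact hP ▸ mem_normalFan_of_isConeFace (finite_pathSums G) (criticalVertex_mem hC) hN
  · rintro ⟨F, ⟨-, u, rfl⟩, rfl⟩
    -- The refinement selects a vertex of the face exposed by `u`.
    obtain ⟨C, hC, hCu⟩ := exists_isGeneric_refinement hG u
    refine ⟨C, hC, ?_⟩
    rw [closure_maxoidCone hG hC, hP]
    exact isConeFace_normalCone (finite_pathSums G) (criticalVertex_mem hC)
      ((forall_pathSums_le_iff hC).2 hCu)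

end Fan

end Maxoid

theorem mainTheorem6 {V : Type*} [Fintype V] (G : Digraph V) (hG : Maxoid.IsAcyclic G) :
    Maxoid.maxoidFan G = Maxoid.normalFan (Maxoid.maxoidPolytope G) ∧
    Maxoid.maxoidPolytope G =
      Maxoid.newtonPolytope (∏ p ∈ Maxoid.connectedPairs G, Maxoid.pathPolynomial G p.1 p.2) ∧
    Maxoid.maxoidFan G =
      Maxoid.normalFan (Maxoid.newtonPolytope
        (∏ p ∈ Maxoid.connectedPairs G, Maxoid.pathPolynomial G p.1 p.2)) := by
  have h1 := Maxoid.maxoidFan_eq_normalFan hG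
  have h2 : Maxoid.maxoidPolytope G = Maxoid.newtonPolytope
      (∏ p ∈ Maxoid.connectedPairs G, Maxoid.pathPolynomial G p.1 p.2) :=
    (Maxoid.newtonPolytope_prod _ fun p m => Maxoid.coeff_pathPolynomial_nonneg p.1 p.2 m).symm
  exact ⟨h1, h2, h2 ▸ h1⟩
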